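/- Consider the first-order language with equality whose symbols are the numerals $m$ and the decimal literals $m/10^{k+1}$ (for $m,k\in\mathbb N$) as constants, the function symbols unary $-$, binary $-$, $+$, $\cdot$, $/$, and the predicate symbols $\le,<,\ge,>$ (the signature of the SMT-LIB theory NRA of nonlinear real arithmetic). A model of NRA is the set $\mathbb R$ with the standard interpretation of all symbols except division, which is interpreted by any function $d:\mathbb R\times\mathbb R\to\mathbb R$ such that $x=d(x,y)\cdot y$ for all $x,y\in\mathbb R$ with $y\neq 0$; thus the values $d(x,0)$ are arbitrary. Formulas may contain quantifiers over the reals. Then real arithmetic with uninterpreted division by zero is undecidable: 1. There is no algorithm which decides, given a formula $\varphi$ (possibly with free variables), whether $\varphi$ is satisfiable, that is, whether there are a model of NRA and an assignment of real numbers to the free variables of $\varphi$ under which $\varphi$ is true. 2. There is no algorithm which decides, given a sentence $\sigma$, whether $\sigma$ belongs to the theory NRA, that is, whether $\sigma$ is true in every model of NRA. Here an algorithm is a total computable function applied to the Gödel number of the input formula. -/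

import Mathlib

namespace NRA

/-- Function symbols of the SMT-LIB signature of real arithmetic, indexed by arity.
`num m` is the numeral `m`; `dec m k` is the decimal literal whose digits are those of `m`, with
`k + 1` of them after the decimal point, i.e. the number `m / 10 ^ (k + 1)`. -/
inductive Func : ℕ → Type
  | num (m : ℕ) : Func 0
  | dec (m k : ℕ) : Func 0
  | neg : Func 1
  | sub : Func 2
  | add : Func 2
  | mul : Func 2
  | div : Func 2

/-- Predicate symbols (equality is a logical symbol). -/
inductive Rel : ℕ → Type
  | le : Rel 2
  | lt : Rel 2
  | ge : Rel 2
  | gt : Rel 2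

/-- The first-order language of NRA. -/
def lang : FirstOrder.Language.{0, 0} := ⟨Func, Rel⟩

/-- The admissible interpretations of division: the values `d x 0` are arbitrary. -/
def IsDivision (d : ℝ → ℝ → ℝ) : Prop :=
  ∀ x y : ℝ, y ≠ 0 → x = d x y * y

/-- Interpretation of the function symbols, with `div` interpreted by `d`. -/
noncomputable def Func.eval (d : ℝ → ℝ → ℝ) : {n : ℕ} → Func n → (Fin n → ℝ) → ℝ
  | _, .num m, _ => (m : ℝ)
  | _, .dec m k, _ => (m : ℝ) / 10 ^ (k + 1)
  | _, .neg, x => - x 0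
  | _, .sub, x => x 0 - x 1
  | _, .add, x => x 0 + x 1
  | _, .mul, x => x 0 * x 1
  | _, .div, x => d (x 0) (x 1)

/-- Interpretation of the predicate symbols. -/
def Rel.holds : {n : ℕ} → Rel n → (Fin n → ℝ) → Prop
  | _, .le, x => x 0 ≤ x 1
  | _, .lt, x => x 0 < x 1
  | _, .ge, x => x 0 ≥ x 1
  | _, .gt, x => x 0 > x 1

/-- The real numbers with the standard interpretation of every symbol except `div`, which is
interpreted by `d`. -/
@[reducible] noncomputable def realStructure (d : ℝ → ℝ → ℝ) : lang.Structure ℝ where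
  funMap := fun f x => Func.eval d f x
  RelMap := fun r x => Rel.holds r x

/-- Satisfiability in NRA of a formula whose free variables (indexed by `ℕ`) play the role of the
free constants of an SMT problem. -/
def Satisfiable (φ : lang.Formula ℕ) : Prop :=
  ∃ d : ℝ → ℝ → ℝ, IsDivision d ∧ ∃ v : ℕ → ℝ,
    @FirstOrder.Language.Formula.Realize lang ℝ (realStructure d) ℕ φ v

/-- The theory NRA: the sentences that hold for every admissible interpretation of division. -/
def theory : lang.Theory :=
  {σ | ∀ d : ℝ → ℝ → ℝ, IsDivision d → @FirstOrder.Language.Sentence.Realize lang ℝ (realStructure d) σ}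

/-! ### Gödel numbering -/

/-- Code of a function symbol. -/
def Func.code : {n : ℕ} → Func n → ℕ
  | _, .num m => Nat.pair 0 m
  | _, .dec m k => Nat.pair 1 (Nat.pair m k)
  | _, .neg => Nat.pair 2 0
  | _, .sub => Nat.pair 3 0
  | _, .add => Nat.pair 4 0
  | _, .mul => Nat.pair 5 0
  | _, .div => Nat.pair 6 0

/-- Code of a predicate symbol. -/
def Rel.code : {n : ℕ} → Rel n → ℕ
  | _, .le => 0
  | _, .lt => 1
  | _, .ge => 2
  | _, .gt => 3

/-- Gödel number of a term; finite sequences of numbers are coded by the standard encoding of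
`List ℕ`. -/
def termCode {β : Type} [Encodable β] : lang.Term β → ℕ
  | .var b => Nat.pair 0 (Encodable.encode b)
  | .func f ts =>
      Nat.pair 1 (Nat.pair (Func.code f) (Encodable.encode (List.ofFn fun i => termCode (ts i))))

/-- Gödel number of a formula. -/
def formulaCode {α : Type} [Encodable α] : {n : ℕ} → lang.BoundedFormula α n → ℕ
  | _, .falsum => Nat.pair 0 0
  | _, .equal t₁ t₂ => Nat.pair 1 (Nat.pair (termCode t₁) (termCode t₂))
  | _, .rel R ts =>
      Nat.pair 2 (Nat.pair (Rel.code R) (Encodable.encode (List.ofFn fun i => termCode (ts i))))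
  | _, .imp φ ψ => Nat.pair 3 (Nat.pair (formulaCode φ) (formulaCode ψ))
  | _, .all φ => Nat.pair 4 (formulaCode φ)

theorem Func.code_inj : ∀ {m n : ℕ} (f : Func m) (g : Func n), f.code = g.code →
    m = n ∧ HEq f g := by
  intro m n f g h
  cases f <;> cases g <;> simp_all [Func.code, Nat.pair_eq_pair]

theorem Rel.code_inj : ∀ {m n : ℕ} (f : Rel m) (g : Rel n), f.code = g.code →
    m = n ∧ HEq f g := by
  intro m n f g h
  cases f <;> cases g <;> simp_all [Rel.code]

theorem termCode_injective {β : Type} [Encodable β] :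
    Function.Injective (termCode : lang.Term β → ℕ) := by
  intro t
  induction t with
  | var b =>
    intro s h
    cases s with
    | var c => simpa [termCode, Nat.pair_eq_pair] using h
    | func g us => simp [termCode, Nat.pair_eq_pair] at h
  | func f ts ih =>
    intro s h
    cases s with
    | var c => simp [termCode, Nat.pair_eq_pair] at h
    | func g us =>
      simp only [termCode, Nat.pair_eq_pair, true_and, Encodable.encode_inj] at h
      obtain ⟨rfl, hf⟩ := Func.code_inj f g h.1
      obtain rfl := eq_of_heq hf
      have := List.ofFn_injective h.2
      congr 1
      funext i
      exact ih i (congrFun this i)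

/-- Distinct formulas have distinct Gödel numbers. -/
theorem formulaCode_injective {α : Type} [Encodable α] {n : ℕ} :
    Function.Injective (formulaCode : lang.BoundedFormula α n → ℕ) := by
  intro φ
  induction φ with
  | falsum => intro ψ h; cases ψ <;> simp_all [formulaCode, Nat.pair_eq_pair]
  | equal t₁ t₂ =>
    intro ψ h
    cases ψ <;> simp [formulaCode, Nat.pair_eq_pair] at h
    rw [termCode_injective h.1, termCode_injective h.2]
  | rel R ts =>
    intro ψ h
    cases ψ with
    | rel S us =>
      simp only [formulaCode, Nat.pair_eq_pair, true_and, Encodable.encode_inj] at h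
      obtain ⟨rfl, hf⟩ := Rel.code_inj R S h.1
      obtain rfl := eq_of_heq hf
      have := List.ofFn_injective h.2
      congr 1
      funext i
      exact termCode_injective (congrFun this i)
    | _ => simp [formulaCode, Nat.pair_eq_pair] at h
  | imp φ₁ φ₂ ih₁ ih₂ =>
    intro ψ h
    cases ψ <;> simp [formulaCode, Nat.pair_eq_pair] at h
    rw [ih₁ h.1, ih₂ h.2]
  | all φ ih =>
    intro ψ h
    cases ψ <;> simp [formulaCode, Nat.pair_eq_pair] at h
    rw [ih h]

/-- A property of formulas with free variables in `α` is decidable if some total computable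
function decides it from Gödel numbers (its values at other numbers do not matter). -/
def AlgorithmicallyDecidable {α : Type} [Encodable α] (P : lang.Formula α → Prop) : Prop :=
  ∃ f : ℕ → Bool, Computable f ∧ ∀ φ : lang.Formula α, f (formulaCode φ) = true ↔ P φ

end NRA

/-!
Division by zero may be interpreted as the indicator function of `ℕ`, and since `ℝ` is Archimedean
a single formula singles out this interpretation: the set `N` where `x / 0` equals `1` must
consist of `0` and of the `x ≥ 1` with `x - 1 ∈ N`. Under it `ℕ` is definable with its addition
and multiplication, so, by Gödel's `β` function, every recursively enumerable predicate is expressed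
by a formula. Conjoining such a formula for the halting problem with the one that fixes the
interpretation reduces the halting problem to satisfiability, and its complement to validity.
-/

open FirstOrder FirstOrder.Language

section DefinableAlong

variable {L : FirstOrder.Language} {M D α β : Type*} [L.Structure M] {e : D → M}

variable (L e) in
/-- A relation on a set `D`, embedded by `e : D → M` in the universe of an `L`-structure `M`, is
definable along `e` if some formula without parameters defines it on tuples from the range of `e`.
What the formula says about tuples outside the range is left open. -/
def DefinableAlong (P : (α → D) → Prop) : Prop :=
  ∃ φ : L.Formula α, ∀ v, φ.Realize (e ∘ v) ↔ P v

variable (L e) in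
/-- A function on `D` is definable along `e` if its graph is; the variable `Sum.inr ()` stands for
the value. -/
def DefinableFunAlong (f : (α → D) → D) : Prop :=
  DefinableAlong L e fun w : α ⊕ Unit → D => f (fun a => w (.inl a)) = w (.inr ())

variable (L e) in
/-- A partial function on `D` is definable along `e` if its graph is; variable `1` stands for the
value. -/
def DefinablePFunAlong (F : D →. D) : Prop :=
  DefinableAlong L e fun v : Fin 2 → D => v 1 ∈ F (v 0)

namespace DefinableAlong

variable {P Q : (α → D) → Prop}

theorem congr (hP : DefinableAlong L e P) (h : ∀ v, Q v ↔ P v) : DefinableAlong L e Q :=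
  (funext fun v => propext (h v) : Q = P) ▸ hP

theorem not (hP : DefinableAlong L e P) : DefinableAlong L e fun v => ¬P v :=
  let ⟨φ, hφ⟩ := hP
  ⟨φ.not, fun v => not_congr (hφ v)⟩

theorem imp (hP : DefinableAlong L e P) (hQ : DefinableAlong L e Q) :
    DefinableAlong L e fun v => P v → Q v :=
  let ⟨φ, hφ⟩ := hP
  let ⟨ψ, hψ⟩ := hQ
  ⟨φ.imp ψ, fun v => imp_congr (hφ v) (hψ v)⟩

theorem and (hP : DefinableAlong L e P) (hQ : DefinableAlong L e Q) :
    DefinableAlong L e fun v => P v ∧ Q v :=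
  let ⟨φ, hφ⟩ := hP
  let ⟨ψ, hψ⟩ := hQ
  ⟨φ ⊓ ψ, fun v => Formula.realize_inf.trans (and_congr (hφ v) (hψ v))⟩

theorem or (hP : DefinableAlong L e P) (hQ : DefinableAlong L e Q) :
    DefinableAlong L e fun v => P v ∨ Q v :=
  let ⟨φ, hφ⟩ := hP
  let ⟨ψ, hψ⟩ := hQ
  ⟨φ ⊔ ψ, fun v => Formula.realize_sup.trans (or_congr (hφ v) (hψ v))⟩

theorem iInf [Finite β] {P : β → (α → D) → Prop} (hP : ∀ b, DefinableAlong L e (P b)) :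
    DefinableAlong L e fun v => ∀ b, P b v := by
  choose φ hφ using hP
  exact ⟨Formula.iInf φ, fun v => Formula.realize_iInf.trans (forall_congr' fun b => hφ b v)⟩

theorem relabel {P : (β → D) → Prop} (hP : DefinableAlong L e P) (g : β → α) :
    DefinableAlong L e fun v : α → D => P fun b => v (g b) :=
  let ⟨φ, hφ⟩ := hP
  ⟨φ.relabel g, fun v => Formula.realize_relabel.trans (hφ (v ∘ g))⟩

theorem var_eq_var (he : Function.Injective e) (a b : α) :
    DefinableAlong L e fun v : α → D => v a = v b :=
  ⟨(Term.var a).equal (Term.var b), fun _ => Formula.realize_equal.trans he.eq_iff⟩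

theorem iExs [Finite β] (hr : (∅ : Set M).Definable₁ L (Set.range e))
    {R : (α → D) → (β → D) → Prop}
    (hR : DefinableAlong L e fun w : α ⊕ β → D =>
      R (fun a => w (.inl a)) (fun b => w (.inr b))) :
    DefinableAlong L e fun v => ∃ u, R v u := by
  obtain ⟨ν, hν⟩ := Set.empty_definable_iff.1 hr
  obtain ⟨φ, hφ⟩ := hR
  have realize_ν (x : Fin 1 → M) : ν.Realize x ↔ x 0 ∈ Set.range e := (Set.ext_iff.1 hν x).symm
  have realize_φ (v : α → D) (u : β → D) :
      φ.Realize (Sum.elim (e ∘ v) (e ∘ u)) ↔ R v u := by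
    rw [← Sum.comp_elim]
    exact hφ (Sum.elim v u)
  refine ⟨Formula.iExs β (Formula.iInf (fun b => ν.relabel fun _ => .inr b) ⊓ φ), fun v => ?_⟩
  simp only [Formula.realize_iExs, Formula.realize_inf, Formula.realize_iInf,
    Formula.realize_relabel, realize_ν, Function.comp_apply, Sum.elim_inr]
  constructor
  · rintro ⟨x, hx, hφx⟩
    choose u hu using hx
    obtain rfl : e ∘ u = x := funext hu
    exact ⟨u, (realize_φ v u).1 hφx⟩
  · rintro ⟨u, hu⟩
    exact ⟨e ∘ u, fun b => ⟨u b, rfl⟩, (realize_φ v u).2 hu⟩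

theorem ex (hr : (∅ : Set M).Definable₁ L (Set.range e)) {R : (α → D) → D → Prop}
    (hR : DefinableAlong L e fun w : α ⊕ Unit → D => R (fun a => w (.inl a)) (w (.inr ()))) :
    DefinableAlong L e fun v => ∃ x, R v x :=
  (iExs hr (R := fun v u => R v (u ())) hR).congr fun _ =>
    ⟨fun ⟨x, hx⟩ => ⟨fun _ => x, hx⟩, fun ⟨u, hu⟩ => ⟨u (), hu⟩⟩

theorem all (hr : (∅ : Set M).Definable₁ L (Set.range e)) {R : (α → D) → D → Prop}
    (hR : DefinableAlong L e fun w : α ⊕ Unit → D => R (fun a => w (.inl a)) (w (.inr ()))) :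
    DefinableAlong L e fun v => ∀ x, R v x :=
  (ex hr (R := fun v x => ¬R v x) hR.not).not.congr fun _ => not_exists_not.symm

theorem comp [Finite β] (hr : (∅ : Set M).Definable₁ L (Set.range e)) {P : (β → D) → Prop}
    (hP : DefinableAlong L e P) {f : β → (α → D) → D} (hf : ∀ b, DefinableFunAlong L e (f b)) :
    DefinableAlong L e fun v => P fun b => f b v :=
  (iExs hr (R := fun v u => (∀ b, f b v = u b) ∧ P u) <|
    (iInf fun b => (hf b).relabel (Sum.map id fun _ => b)).and (hP.relabel Sum.inr)).congr fun v =>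
      ⟨fun h => ⟨fun b => f b v, fun _ => rfl, h⟩, fun ⟨_, hu, h⟩ => funext hu ▸ h⟩

end DefinableAlong

namespace DefinableFunAlong

variable {f g : (α → D) → D}

theorem relabel {f : (β → D) → D} (hf : DefinableFunAlong L e f) (k : β → α) :
    DefinableFunAlong L e fun v : α → D => f fun b => v (k b) :=
  DefinableAlong.relabel hf (Sum.map k id)

theorem weaken (hf : DefinableFunAlong L e f) :
    DefinableFunAlong L e fun w : α ⊕ β → D => f fun a => w (.inl a) :=
  hf.relabel Sum.inl

theorem proj (he : Function.Injective e) (a : α) :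
    DefinableFunAlong L e fun v : α → D => v a :=
  .var_eq_var he _ _

theorem comp [Finite β] (he : Function.Injective e)
    (hr : (∅ : Set M).Definable₁ L (Set.range e)) {k : (β → D) → D}
    (hk : DefinableFunAlong L e k) {f : β → (α → D) → D}
    (hf : ∀ b, DefinableFunAlong L e (f b)) :
    DefinableFunAlong L e fun v => k fun b => f b v := by
  let g : β ⊕ Unit → (α ⊕ Unit → D) → D :=
    Sum.elim (fun b w => f b fun a => w (.inl a)) fun _ w => w (.inr ())
  have hg : ∀ c, DefinableFunAlong L e (g c)
    | .inl b => (hf b).weaken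
    | .inr _ => proj he _
  exact DefinableAlong.comp hr hk hg

theorem comp₂ (he : Function.Injective e) (hr : (∅ : Set M).Definable₁ L (Set.range e))
    {k : D → D → D} (hk : DefinableFunAlong L e fun v : Fin 2 → D => k (v 0) (v 1))
    (hf : DefinableFunAlong L e f) (hg : DefinableFunAlong L e g) :
    DefinableFunAlong L e fun v => k (f v) (g v) :=
  hk.comp he hr (f := ![f, g]) (Fin.forall_fin_two.2 ⟨hf, hg⟩)

theorem ite {P : (α → D) → Prop} [DecidablePred P] (hP : DefinableAlong L e P)
    (hf : DefinableFunAlong L e f) (hg : DefinableFunAlong L e g) :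
    DefinableFunAlong L e fun v => if P v then f v else g v :=
  (((hP.relabel Sum.inl).and hf).or ((hP.relabel Sum.inl).not.and hg)).congr fun w => by
    by_cases h : P fun a => w (.inl a) <;> simp [h]

end DefinableFunAlong

theorem DefinableAlong.eq (he : Function.Injective e)
    (hr : (∅ : Set M).Definable₁ L (Set.range e)) {f g : (α → D) → D}
    (hf : DefinableFunAlong L e f) (hg : DefinableFunAlong L e g) :
    DefinableAlong L e fun v => f v = g v :=
  (var_eq_var he (0 : Fin 2) 1).comp hr (f := ![f, g]) (Fin.forall_fin_two.2 ⟨hf, hg⟩)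

theorem DefinablePFunAlong.mem {F : D →. D} (hF : DefinablePFunAlong L e F)
    (hr : (∅ : Set M).Definable₁ L (Set.range e)) {f g : (α → D) → D}
    (hf : DefinableFunAlong L e f) (hg : DefinableFunAlong L e g) :
    DefinableAlong L e fun v => g v ∈ F (f v) :=
  DefinableAlong.comp hr hF (f := ![f, g]) (Fin.forall_fin_two.2 ⟨hf, hg⟩)

end DefinableAlong

/-- An embedding of `ℕ` into an `L`-structure interprets arithmetic if its range is definable and
addition and multiplication of natural numbers are definable along it. -/
structure InterpretsArithmetic (L : FirstOrder.Language) {M : Type*} [L.Structure M]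
    (e : ℕ → M) : Prop where
  injective : Function.Injective e
  definable_range : (∅ : Set M).Definable₁ L (Set.range e)
  definable_add : DefinableFunAlong L e fun v : Fin 2 → ℕ => v 0 + v 1
  definable_mul : DefinableFunAlong L e fun v : Fin 2 → ℕ => v 0 * v 1

theorem unpair_fst_eq_iff {n a : ℕ} : n.unpair.1 = a ↔ ∃ b, Nat.pair a b = n :=
  ⟨fun h => ⟨n.unpair.2, h ▸ Nat.pair_unpair n⟩, fun ⟨b, h⟩ => by rw [← h, Nat.unpair_pair]⟩

theorem unpair_snd_eq_iff {n b : ℕ} : n.unpair.2 = b ↔ ∃ a, Nat.pair a b = n :=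
  ⟨fun h => ⟨n.unpair.1, h ▸ Nat.pair_unpair n⟩, fun ⟨a, h⟩ => by rw [← h, Nat.unpair_pair]⟩

namespace InterpretsArithmetic

variable {L : FirstOrder.Language} {M α : Type*} [L.Structure M] {e : ℕ → M}
  {f g : (α → ℕ) → ℕ}

theorem proj (h : InterpretsArithmetic L e) (a : α) : DefinableFunAlong L e fun v => v a :=
  .proj h.injective a

theorem ex (h : InterpretsArithmetic L e) {R : (α → ℕ) → ℕ → Prop}
    (hR : DefinableAlong L e fun w : α ⊕ Unit → ℕ => R (fun a => w (.inl a)) (w (.inr ()))) :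
    DefinableAlong L e fun v => ∃ x, R v x :=
  .ex h.definable_range hR

theorem eq (h : InterpretsArithmetic L e) (hf : DefinableFunAlong L e f)
    (hg : DefinableFunAlong L e g) : DefinableAlong L e fun v => f v = g v :=
  .eq h.injective h.definable_range hf hg

theorem add (h : InterpretsArithmetic L e) (hf : DefinableFunAlong L e f)
    (hg : DefinableFunAlong L e g) : DefinableFunAlong L e fun v => f v + g v :=
  h.definable_add.comp₂ h.injective h.definable_range hf hg

theorem mul (h : InterpretsArithmetic L e) (hf : DefinableFunAlong L e f)
    (hg : DefinableFunAlong L e g) : DefinableFunAlong L e fun v => f v * g v :=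
  h.definable_mul.comp₂ h.injective h.definable_range hf hg

theorem zero (h : InterpretsArithmetic L e) : DefinableFunAlong L e fun _ : α → ℕ => 0 :=
  (h.eq (h.add (h.proj (.inr ())) (h.proj (.inr ()))) (h.proj (.inr ()))).congr fun _ => by
    lia

theorem one (h : InterpretsArithmetic L e) : DefinableFunAlong L e fun _ : α → ℕ => 1 :=
  ((h.eq (h.proj (.inr ())) h.zero).not.and
    (h.eq (h.mul (h.proj (.inr ())) (h.proj (.inr ()))) (h.proj (.inr ())))).congr fun _ =>
      ⟨fun h1 => by simp [← h1], fun ⟨h0, hsq⟩ => ((mul_eq_left₀ h0).1 hsq).symm⟩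

theorem lt (h : InterpretsArithmetic L e) (hf : DefinableFunAlong L e f)
    (hg : DefinableFunAlong L e g) : DefinableAlong L e fun v => f v < g v :=
  (h.ex (R := fun v n => g v + n = f v)
    (h.eq (h.add hg.weaken (h.proj _)) hf.weaken)).not.congr fun _ => by
      simp only [@eq_comm _ (_ + _), ← le_iff_exists_add, not_le]

theorem natPair (h : InterpretsArithmetic L e) (hf : DefinableFunAlong L e f)
    (hg : DefinableFunAlong L e g) : DefinableFunAlong L e fun v => Nat.pair (f v) (g v) :=
  .ite (h.lt hf hg) (h.add (h.mul hg hg) hf) (h.add (h.add (h.mul hf hf) hf) hg)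

theorem unpair_fst (h : InterpretsArithmetic L e) (hf : DefinableFunAlong L e f) :
    DefinableFunAlong L e fun v => (f v).unpair.1 :=
  (h.ex (R := fun w b => Nat.pair (w (.inr ())) b = f fun a => w (.inl a)) <|
    h.eq (h.natPair (h.proj _) (h.proj _)) hf.weaken.weaken).congr fun _ =>
      unpair_fst_eq_iff

theorem unpair_snd (h : InterpretsArithmetic L e) (hf : DefinableFunAlong L e f) :
    DefinableFunAlong L e fun v => (f v).unpair.2 :=
  (h.ex (R := fun w a => Nat.pair a (w (.inr ())) = f fun a => w (.inl a)) <|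
    h.eq (h.natPair (h.proj _) (h.proj _)) hf.weaken.weaken).congr fun _ =>
      unpair_snd_eq_iff

theorem mod (h : InterpretsArithmetic L e) (hf : DefinableFunAlong L e f)
    (hg : DefinableFunAlong L e g) : DefinableFunAlong L e fun v => f v % g v :=
  (((h.eq hg.weaken h.zero).and (h.eq hf.weaken (h.proj _))).or
    ((h.lt (h.proj _) hg.weaken).and
      (h.ex (R := fun w q => f (fun a => w (.inl a)) = g (fun a => w (.inl a)) * q + w (.inr ())) <|
        h.eq hf.weaken.weaken (h.add (h.mul hg.weaken.weaken (h.proj _)) (h.proj _))))).congr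
    fun _ => Nat.mod_eq_iff

theorem natBeta (h : InterpretsArithmetic L e) (hf : DefinableFunAlong L e f)
    (hg : DefinableFunAlong L e g) : DefinableFunAlong L e fun v => Nat.beta (f v) (g v) :=
  h.mod (h.unpair_fst hf) (h.add (h.mul (h.add hg h.one) (h.unpair_snd hf)) h.one)

end InterpretsArithmetic

theorem mem_natRec_bind_iff_exists_seq {σ : Type*} {p : Part σ} {q : ℕ → σ → Part σ}
    {n : ℕ} {b : σ} :
    b ∈ (n.rec p fun i IH => IH >>= q i : Part σ) ↔
      ∃ u : ℕ → σ, u 0 ∈ p ∧ u n = b ∧ ∀ i < n, u (i + 1) ∈ q i (u i) := by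
  constructor
  · intro hb
    induction n generalizing b with
    | zero => exact ⟨fun _ => b, hb, rfl, by simp⟩
    | succ n ih =>
      obtain ⟨a, ha, hab⟩ := Part.mem_bind_iff.1 hb
      obtain ⟨u, h0, rfl, hu⟩ := ih ha
      refine ⟨Function.update u (n + 1) b, by simpa using h0, by simp, fun i hi => ?_⟩
      rcases (Nat.lt_succ_iff.1 hi).lt_or_eq with hlt | rfl
      · simpa [Function.update_of_ne, hi.ne, hlt.ne] using hu i hlt
      · simpa using hab
  · rintro ⟨u, h0, rfl, hu⟩
    induction n with
    | zero => exact h0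
    | succ n ih =>
      exact Part.mem_bind (ih fun i hi => hu i (hi.trans n.lt_succ_self)) (hu n n.lt_succ_self)

theorem exists_natBeta_eq (u : ℕ → ℕ) (n : ℕ) : ∃ c, ∀ i ≤ n, Nat.beta c i = u i := by
  refine ⟨Nat.unbeta ((List.range (n + 1)).map u), fun i hi => ?_⟩
  simpa using! Nat.beta_unbeta_coe ((List.range (n + 1)).map u)
    ⟨i, by simpa using Nat.lt_succ_of_le hi⟩

theorem mem_natRec_bind_iff_exists_beta {p : Part ℕ} {q : ℕ → ℕ → Part ℕ} {n b : ℕ} :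
    b ∈ (n.rec p fun i IH => IH >>= q i : Part ℕ) ↔ ∃ c, Nat.beta c 0 ∈ p ∧ Nat.beta c n = b ∧
      ∀ i < n, Nat.beta c (i + 1) ∈ q i (Nat.beta c i) := by
  rw [mem_natRec_bind_iff_exists_seq]
  constructor
  · rintro ⟨u, h0, hn, hu⟩
    obtain ⟨c, hc⟩ := exists_natBeta_eq u n
    refine ⟨c, hc 0 n.zero_le ▸ h0, (hc n le_rfl).trans hn, fun i hi => ?_⟩
    rw [hc i hi.le, hc (i + 1) hi]
    exact hu i hi
  · rintro ⟨c, hc⟩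
    exact ⟨Nat.beta c, hc⟩

theorem mem_map_pair_seq_iff {p q : Part ℕ} {n : ℕ} :
    n ∈ Nat.pair <$> p <*> q ↔ n.unpair.1 ∈ p ∧ n.unpair.2 ∈ q := by
  have mem_seq : n ∈ Nat.pair <$> p <*> q ↔ ∃ a ∈ p, ∃ b ∈ q, Nat.pair a b = n := by
    simp [Seq.seq]
  rw [mem_seq]
  constructor
  · rintro ⟨a, ha, b, hb, rfl⟩
    simpa using ⟨ha, hb⟩
  · exact fun ⟨ha, hb⟩ => ⟨_, ha, _, hb, Nat.pair_unpair n⟩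

theorem mem_rfind_eq_zero_iff {p : ℕ → Part ℕ} {n : ℕ} :
    n ∈ Nat.rfind (fun i => (fun m => decide (m = 0)) <$> p i) ↔
      0 ∈ p n ∧ ∀ i < n, ∃ m, m ≠ 0 ∧ m ∈ p i := by
  refine Nat.mem_rfind.trans ?_
  simp [and_comm]

namespace InterpretsArithmetic

variable {L : FirstOrder.Language} {M : Type*} [L.Structure M] {e : ℕ → M}

theorem definable_prec (h : InterpretsArithmetic L e) {F G : ℕ →. ℕ}
    (hF : DefinablePFunAlong L e F) (hG : DefinablePFunAlong L e G) :
    DefinablePFunAlong L e (Nat.unpaired fun a n =>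
      n.rec (F a) fun i IH => IH >>= fun r => G (Nat.pair a (Nat.pair i r))) := by
  have hr := h.definable_range
  refine DefinableAlong.congr ?_ fun _ => mem_natRec_bind_iff_exists_beta
  refine h.ex (.and ?_ (.and ?_ (.all hr (.imp ?_ ?_))))
  · exact hF.mem hr (h.unpair_fst (h.proj _)) (h.natBeta (h.proj _) h.zero)
  · exact h.eq (h.natBeta (h.proj _) (h.unpair_snd (h.proj _))) (h.proj _)
  · exact h.lt (h.proj _) (h.unpair_snd (h.proj _))
  · exact hG.mem hr
      (h.natPair (h.unpair_fst (h.proj _))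
        (h.natPair (h.proj _) (h.natBeta (h.proj _) (h.proj _))))
      (h.natBeta (h.proj _) (h.add (h.proj _) h.one))

theorem definable_rfind (h : InterpretsArithmetic L e) {F : ℕ →. ℕ}
    (hF : DefinablePFunAlong L e F) :
    DefinablePFunAlong L e fun a =>
      Nat.rfind fun n => (fun m => decide (m = 0)) <$> F (Nat.pair a n) := by
  have hr := h.definable_range
  refine DefinableAlong.congr (.and ?_ (.all hr (.imp ?_ (h.ex (.and (.not ?_) ?_)))))
    fun _ => mem_rfind_eq_zero_iff
  · exact hF.mem hr (h.natPair (h.proj _) (h.proj _)) h.zero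
  · exact h.lt (h.proj _) (h.proj _)
  · exact h.eq (h.proj _) h.zero
  · exact hF.mem hr (h.natPair (h.proj _) (h.proj _)) (h.proj _)

theorem definable_of_partrec (h : InterpretsArithmetic L e) {F : ℕ →. ℕ} (hF : Nat.Partrec F) :
    DefinablePFunAlong L e F := by
  have hr := h.definable_range
  induction hF with
  | zero => exact (h.eq (h.proj 1) h.zero).congr fun _ => Part.mem_some_iff
  | succ => exact (h.eq (h.proj 1) (h.add (h.proj 0) h.one)).congr fun _ => Part.mem_some_iff
  | left => exact (h.eq (h.proj 1) (h.unpair_fst (h.proj 0))).congr fun _ => Part.mem_some_iff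
  | right => exact (h.eq (h.proj 1) (h.unpair_snd (h.proj 0))).congr fun _ => Part.mem_some_iff
  | pair _ _ hf hg =>
    exact ((hf.mem hr (h.proj 0) (h.unpair_fst (h.proj 1))).and
      (hg.mem hr (h.proj 0) (h.unpair_snd (h.proj 1)))).congr fun _ => mem_map_pair_seq_iff
  | @comp f g _ _ hf hg =>
    exact DefinableAlong.congr (P := fun v => ∃ a, a ∈ g (v 0) ∧ v 1 ∈ f a)
      (h.ex ((hg.mem hr (h.proj _) (h.proj _)).and (hf.mem hr (h.proj _) (h.proj _))))
      fun _ => Part.mem_bind_iff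
  | prec _ _ hf hg => exact h.definable_prec hf hg
  | rfind _ hf => exact h.definable_rfind hf

theorem exists_formula_of_rePred {A : Type*} [Primcodable A] (h : InterpretsArithmetic L e)
    {p : A → Prop} (hp : REPred p) :
    ∃ φ : L.Formula Unit, ∀ a, φ.Realize (fun _ => e (Encodable.encode a)) ↔ p a := by
  obtain ⟨F, hF, hpF⟩ : ∃ F : ℕ →. ℕ, Nat.Partrec F ∧ ∀ a, (F (Encodable.encode a)).Dom ↔ p a :=
    ⟨_, hp, fun a => by simp [Part.assert]⟩
  obtain ⟨φ, hφ⟩ : DefinableAlong L e fun v : Unit → ℕ => ∃ b, b ∈ F (v ()) :=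
    h.ex ((h.definable_of_partrec hF).mem h.definable_range (h.proj (Sum.inl ()))
      (h.proj (Sum.inr ())))
  exact ⟨φ, fun a => (hφ fun _ => Encodable.encode a).trans (Part.dom_iff_mem.symm.trans (hpF a))⟩

end InterpretsArithmetic

theorem mem_range_natCast_iff_eq_zero_or {R : Type*} [Ring R] [LinearOrder R]
    [IsStrictOrderedRing R] {x : R} :
    x ∈ Set.range ((↑) : ℕ → R) ↔ x = 0 ∨ 1 ≤ x ∧ x - 1 ∈ Set.range ((↑) : ℕ → R) := by
  constructor
  · rintro ⟨_ | n, rfl⟩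
    · exact .inl Nat.cast_zero
    · exact .inr ⟨by simp, n, by simp⟩
  · rintro (rfl | ⟨-, n, hn⟩)
    · exact ⟨0, Nat.cast_zero⟩
    · exact ⟨n + 1, by simp [hn]⟩

theorem eq_range_natCast_of_mem_iff {R : Type*} [Ring R] [LinearOrder R] [IsStrictOrderedRing R]
    [Archimedean R] {S : Set R} (hS : ∀ x, x ∈ S ↔ x = 0 ∨ 1 ≤ x ∧ x - 1 ∈ S) :
    S = Set.range ((↑) : ℕ → R) := by
  have mem_iff_of_lt (n : ℕ) : ∀ x < (n : R), x ∈ S ↔ x ∈ Set.range ((↑) : ℕ → R) := by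
    induction n with
    | zero =>
      intro x hx
      rw [Nat.cast_zero] at hx
      rw [hS, mem_range_natCast_iff_eq_zero_or]
      simp [hx.ne, (hx.trans zero_lt_one).not_ge]
    | succ n ih =>
      intro x hx
      have hx' : x - 1 < n := by rwa [sub_lt_iff_lt_add, ← Nat.cast_succ]
      rw [hS, mem_range_natCast_iff_eq_zero_or, ih _ hx']
  ext x
  obtain ⟨n, hn⟩ := exists_nat_gt x
  exact mem_iff_of_lt n x hn

namespace NRA

open scoped FirstOrder

section Terms

variable {β : Type*}

instance : NatCast (lang.Term β) := ⟨fun m => Constants.term (L := lang) (Func.num m)⟩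

instance : Add (lang.Term β) := ⟨Functions.apply₂ (L := lang) Func.add⟩

instance : Sub (lang.Term β) := ⟨Functions.apply₂ (L := lang) Func.sub⟩

instance : Mul (lang.Term β) := ⟨Functions.apply₂ (L := lang) Func.mul⟩

instance : Div (lang.Term β) := ⟨Functions.apply₂ (L := lang) Func.div⟩

variable (d : ℝ → ℝ → ℝ) (s t : lang.Term β) (v : β → ℝ)

theorem realize_natCast (m : ℕ) :
    letI := realStructure d
    (m : lang.Term β).realize v = (m : ℝ) := rfl

theorem realize_sub :
    letI := realStructure d
    (s - t).realize v = s.realize v - t.realize v := rfl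

theorem realize_div :
    letI := realStructure d
    (s / t).realize v = d (s.realize v) (t.realize v) := rfl

end Terms

section NatDivision

/-- The division for which `x / 0` is the indicator function of `ℕ`. -/
noncomputable def natDivision (x y : ℝ) : ℝ :=
  if y = 0 then (Set.range ((↑) : ℕ → ℝ)).indicator 1 x else x / y

theorem isDivision_natDivision : IsDivision natDivision := fun x y hy => by
  rw [natDivision, if_neg hy, div_mul_cancel₀ x hy]

theorem natDivision_zero (x : ℝ) :
    natDivision x 0 = (Set.range ((↑) : ℕ → ℝ)).indicator 1 x := if_pos rfl

theorem natDivision_zero_eq_one_iff {x : ℝ} :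
    natDivision x 0 = 1 ↔ x ∈ Set.range ((↑) : ℕ → ℝ) := by
  rw [natDivision_zero, Set.indicator_eq_one_iff_mem]

variable {d d' : ℝ → ℝ → ℝ}

theorem IsDivision.eq_iff (hd : IsDivision d) (hd' : IsDivision d') :
    d = d' ↔ ∀ x, d x 0 = d' x 0 := by
  refine ⟨fun h x => h ▸ rfl, fun h => funext₂ fun x y => ?_⟩
  rcases eq_or_ne y 0 with rfl | hy
  · exact h x
  · exact mul_right_cancel₀ hy ((hd x y hy).symm.trans (hd' x y hy))

theorem IsDivision.eq_natDivision_iff (hd : IsDivision d) :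
    d = natDivision ↔ ∀ x, (x = 0 ∨ 1 ≤ x ∧ d (x - 1) 0 = 1 → d x 0 = 1) ∧
      (¬(x = 0 ∨ 1 ≤ x ∧ d (x - 1) 0 = 1) → d x 0 = 0) := by
  constructor
  · rintro rfl x
    simp only [natDivision_zero_eq_one_iff, ← mem_range_natCast_iff_eq_zero_or]
    exact ⟨id, fun hx => (natDivision_zero x).trans (Set.indicator_of_notMem hx 1)⟩
  · intro h
    have one_iff (x : ℝ) : d x 0 = 1 ↔ x = 0 ∨ 1 ≤ x ∧ d (x - 1) 0 = 1 :=
      ⟨fun h1 => by_contra fun hx => one_ne_zero (h1.symm.trans ((h x).2 hx)), (h x).1⟩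
    have setOf_eq : {x | d x 0 = 1} = Set.range ((↑) : ℕ → ℝ) :=
      eq_range_natCast_of_mem_iff one_iff
    refine (hd.eq_iff isDivision_natDivision).2 fun x => ?_
    rw [natDivision_zero, ← setOf_eq]
    by_cases hx : d x 0 = 1
    · exact hx.trans (Set.indicator_of_mem (s := {x | d x 0 = 1}) hx 1).symm
    · exact ((h x).2 (mt (one_iff x).2 hx)).trans
        (Set.indicator_of_notMem (s := {x | d x 0 = 1}) hx 1).symm

/-- The formula saying that `x / 0` is `1` or `0` according to whether `x = 0`, or `1 ≤ x` and
`(x - 1) / 0 = 1`. -/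
def natDivisionFormula (α : Type*) : lang.Formula α :=
  let x : lang.Term (α ⊕ Fin 1) := &0
  let zero : lang.Term (α ⊕ Fin 1) := (0 : ℕ)
  let one : lang.Term (α ⊕ Fin 1) := (1 : ℕ)
  let isNat : lang.BoundedFormula α 1 :=
    x.bdEqual zero ⊔
      (Relations.boundedFormula₂ (L := lang) Rel.le one x ⊓ ((x - one) / zero).bdEqual one)
  ((isNat ⟹ (x / zero).bdEqual one) ⊓ (∼isNat ⟹ (x / zero).bdEqual zero)).all

theorem realize_natDivisionFormula {α : Type*} (hd : IsDivision d) (v : α → ℝ) :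
    letI := realStructure d
    (natDivisionFormula α).Realize v ↔ d = natDivision := by
  let := realStructure d
  have realize_le (s t : lang.Term (α ⊕ Fin 1)) (xs : Fin 1 → ℝ) :
      (Relations.boundedFormula₂ (L := lang) Rel.le s t).Realize v xs ↔
        s.realize (Sum.elim v xs) ≤ t.realize (Sum.elim v xs) := Iff.rfl
  rw [hd.eq_natDivision_iff]
  simp only [natDivisionFormula, Formula.Realize, BoundedFormula.realize_all,
    BoundedFormula.realize_inf, BoundedFormula.realize_sup, BoundedFormula.realize_imp,
    BoundedFormula.realize_not, BoundedFormula.realize_bdEqual, realize_le, realize_div,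
    realize_sub, realize_natCast, Nat.cast_zero, Nat.cast_one]
  rfl

theorem interpretsArithmetic_natDivision :
    letI := realStructure natDivision
    InterpretsArithmetic lang ((↑) : ℕ → ℝ) := by
  let := realStructure natDivision
  have cast_add_eq_iff (a b c : ℕ) : (a + b : ℝ) = c ↔ a + b = c := by norm_cast
  have cast_mul_eq_iff (a b c : ℕ) : (a * b : ℝ) = c ↔ a * b = c := by norm_cast
  refine ⟨Nat.cast_injective, Set.empty_definable_iff.2
    ⟨Term.equal (Term.var 0 / ((0 : ℕ) : lang.Term (Fin 1))) (1 : ℕ), ?_⟩,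
    ⟨Term.equal (Term.var (.inl 0) + Term.var (.inl 1)) (Term.var (.inr ())), fun v => ?_⟩,
    ⟨Term.equal (Term.var (.inl 0) * Term.var (.inl 1)) (Term.var (.inr ())), fun v => ?_⟩⟩
  · ext x
    simp only [Set.mem_ofPred_eq, Formula.realize_equal, realize_div, realize_natCast,
      Term.realize_var, Nat.cast_zero, Nat.cast_one, natDivision_zero_eq_one_iff]
  · exact Formula.realize_equal.trans (cast_add_eq_iff _ _ _)
  · exact Formula.realize_equal.trans (cast_mul_eq_iff _ _ _)

theorem exists_formula_realize_iff_eq_natDivision_and {A : Type*} [Primcodable A]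
    {p : A → Prop} (hp : REPred p) :
    ∃ φ : lang.Formula Unit, ∀ d, IsDivision d → ∀ a,
      letI := realStructure d
      φ.Realize (fun _ => (Encodable.encode a : ℝ)) ↔ d = natDivision ∧ p a := by
  let := realStructure natDivision
  obtain ⟨φ, hφ⟩ := interpretsArithmetic_natDivision.exists_formula_of_rePred hp
  refine ⟨natDivisionFormula Unit ⊓ φ, fun d hd a => ?_⟩
  let := realStructure d
  rw [Formula.realize_inf, realize_natDivisionFormula hd]
  refine and_congr_right ?_
  rintro rfl
  exact hφ a

end NatDivision

section AtNumeral

/-- The instance `φ(n)` of `φ` at the numeral `n`, in the form `∀ x, x = n → φ(x)`. -/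
def atNumeral {α : Type*} (φ : lang.Formula Unit) (n : ℕ) : lang.Formula α :=
  (Term.bdEqual &0 (n : lang.Term (α ⊕ Fin 1)) ⟹
    BoundedFormula.relabel (fun _ => Sum.inr (0 : Fin 1)) φ).all

theorem realize_atNumeral {α : Type*} (d : ℝ → ℝ → ℝ) (φ : lang.Formula Unit) (n : ℕ)
    (v : α → ℝ) :
    letI := realStructure d
    (atNumeral φ n).Realize v ↔ φ.Realize fun _ => (n : ℝ) := by
  let := realStructure d
  have realize_relabel (x : ℝ) :
      (BoundedFormula.relabel (fun _ => Sum.inr (0 : Fin 1)) φ).Realize v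
        (Fin.snoc default x) ↔ φ.Realize fun _ => x := by
    rw [BoundedFormula.realize_relabel, Formula.Realize]
    exact iff_of_eq (congrArg _ (Subsingleton.elim _ _))
  exact (forall_congr' fun x => imp_congr Iff.rfl (realize_relabel x)).trans forall_eq

theorem computable_formulaCode_atNumeral {α : Type} [Encodable α]
    (φ : lang.Formula Unit) :
    Computable fun n => formulaCode (atNumeral φ n : lang.Formula α) := by
  have pair {f g : ℕ → ℕ} (hf : Primrec f) (hg : Primrec g) :
      Primrec fun n => Nat.pair (f n) (g n) := Primrec₂.natPair.comp hf hg
  have const (m : ℕ) : Primrec fun _ : ℕ => m := .const m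
  have numeral : Primrec fun n : ℕ => termCode (n : lang.Term (α ⊕ Fin 1)) :=
    pair (const 1) (pair (pair (const 0) .id) (const _))
  exact (pair (const 4) (pair (const 3) (pair (pair (const 1) (pair (const _) numeral))
    (const _)))).to_comp

theorem AlgorithmicallyDecidable.computablePred {α : Type} [Encodable α] {A : Type*}
    [Primcodable A] {P : lang.Formula α → Prop} (hP : AlgorithmicallyDecidable P)
    {φ : A → lang.Formula α} (hφ : Computable fun a => formulaCode (φ a)) :
    ComputablePred fun a => P (φ a) :=
  let ⟨f, hf, hfP⟩ := hP
  ComputablePred.computable_iff.2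
    ⟨fun a => f (formulaCode (φ a)), hf.comp hφ, funext fun a => propext (hfP (φ a)).symm⟩

end AtNumeral

theorem not_algorithmicallyDecidable_satisfiable :
    ¬AlgorithmicallyDecidable (α := ℕ) Satisfiable := by
  intro hdec
  obtain ⟨φ, hφ⟩ :=
    exists_formula_realize_iff_eq_natDivision_and (ComputablePred.halting_problem_re 0)
  have satisfiable_iff (c : Nat.Partrec.Code) :
      Satisfiable (atNumeral φ (Encodable.encode c)) ↔ (c.eval 0).Dom := by
    constructor
    · rintro ⟨d, hd, v, hv⟩
      exact ((hφ d hd c).1 ((realize_atNumeral d φ _ v).1 hv)).2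
    · exact fun hc => ⟨natDivision, isDivision_natDivision, 0, (realize_atNumeral _ φ _ _).2 <|
        (hφ _ isDivision_natDivision c).2 ⟨rfl, hc⟩⟩
  exact ComputablePred.halting_problem 0 <|
    (hdec.computablePred <| (computable_formulaCode_atNumeral φ).comp .encode).of_eq satisfiable_iff

theorem not_algorithmicallyDecidable_theory :
    ¬AlgorithmicallyDecidable (α := Empty) fun σ => σ ∈ theory := by
  intro hdec
  obtain ⟨φ, hφ⟩ :=
    exists_formula_realize_iff_eq_natDivision_and (ComputablePred.halting_problem_re 0)
  have mem_theory_iff (c : Nat.Partrec.Code) :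
      atNumeral φ.not (Encodable.encode c) ∈ theory ↔ ¬(c.eval 0).Dom := by
    constructor
    · exact fun h hc => (realize_atNumeral _ φ.not _ _).1 (h _ isDivision_natDivision) <|
        (hφ _ isDivision_natDivision c).2 ⟨rfl, hc⟩
    · exact fun hc d hd => (realize_atNumeral d φ.not _ _).2 fun h => hc ((hφ d hd c).1 h).2
  have not_mem_theory_iff (c : Nat.Partrec.Code) := (not_congr (mem_theory_iff c)).trans not_not
  exact ComputablePred.halting_problem 0 <|
    (hdec.computablePred <|
      (computable_formulaCode_atNumeral φ.not).comp .encode).not.of_eq not_mem_theory_iff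

end NRA

/-- Real arithmetic with uninterpreted division by zero is undecidable: no algorithm decides
satisfiability of formulas, and no algorithm decides which sentences belong to the theory. -/
theorem lemma2 :
    ¬ NRA.AlgorithmicallyDecidable (α := ℕ) NRA.Satisfiable ∧
      ¬ NRA.AlgorithmicallyDecidable (α := Empty) (fun σ => σ ∈ NRA.theory) :=
  ⟨NRA.not_algorithmicallyDecidable_satisfiable, NRA.not_algorithmicallyDecidable_theory⟩
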